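/- Let $S=(-\frac{\pi}{2},\frac{\pi}{2})^2\subset\mathbb R^2$ and let $z_0=(\pm\frac{\pi}{2},\pm\frac{\pi}{2})$ be one of its corners. Let $D$ be the diagonal of $\overline S$ through $z_0$ (the part in $\overline S$ of the line $y=x$ or $y=-x$). Let $\theta_0\in\mathbb R$ and $h_0,\epsilon_1,\eta_1>0$. For $|\theta-\theta_0|<\eta_1$ and $h\in[0,h_0)$, let $\Phi(\cdot,\theta,h)$ be an eigenfunction of the Laplacian on $S$ with the $h$-Robin condition and eigenvalue $\lambda(h)$, that is, a function that is smooth on $\overline S$, not identically zero, and satisfies $$-\Delta\Phi(\cdot,\theta,h)=\lambda(h)\,\Phi(\cdot,\theta,h)\ \text{ in } S,\qquad \partial_\nu\Phi(\cdot,\theta,h)+h\,\Phi(\cdot,\theta,h)=0\ \text{ on the open sides of } S,$$ where $\nu$ is the outward-pointing unit normal. Suppose that $\Phi$ is jointly $C^\infty$ in $(x,y,\theta,h)$ for $(x,y)\in\overline S\cap B(z_0,\epsilon_1)$, $|\theta-\theta_0|<\eta_1$, $h\in[0,h_0)$, and that $$\Phi(z,\theta_0,h)=0\ \text{ for all } z\in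 D,\ h\in[0,h_0),\qquad \nabla\Phi(z_0,\theta_0,h)=0\ \text{ for all } h\in[0,h_0),$$ $$\partial_y^2\Phi(z_0,\theta_0,0)\neq0,\qquad \partial_\theta\Phi(z_0,\theta_0,0)\neq0$$ (derivatives in $(x,y)$ at boundary points are taken within $\overline S$). Then there exist $\epsilon_0\in(0,\epsilon_1)$ and $\eta_0\in(0,\min(\eta_1,h_0))$ such that, for all $\theta\in\mathbb R$ and $h\ge0$ with $|\theta-\theta_0|+h\le\eta_0$, the function $\Phi(\cdot,\theta,h)$ has exactly $2$ nodal domains in $B(z_0,\epsilon_0)\cap S$; that is, the set $\{z\in B(z_0,\epsilon_0)\cap S:\Phi(z,\theta,h)\ne0\}$ has exactly two connected components. -/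

import Mathlib

open scoped ContDiff

namespace RobinSquare

/-- The Euclidean plane. -/
abbrev Plane : Type := EuclideanSpace ℝ (Fin 2)

/-- The open square `S = (-π/2, π/2)²`. -/
def square : Set Plane := {z | ∀ i, |z i| < Real.pi / 2}

/-- The closed square, i.e. the closure of `S`. -/
def closedSquare : Set Plane := {z | ∀ i, |z i| ≤ Real.pi / 2}

/-- `z` is one of the four corners `(± π/2, ± π/2)` of the square. -/
def IsCorner (z : Plane) : Prop := ∀ i, |z i| = Real.pi / 2

/-- `z` lies on an open side of the square and `ν` is the outward-pointing unit normal there. -/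
def IsOutwardNormal (z ν : Plane) : Prop :=
  ∃ i : Fin 2, ∃ s : ℝ, (s = 1 ∨ s = -1) ∧ z i = s * (Real.pi / 2) ∧
    (∀ j, j ≠ i → |z j| < Real.pi / 2) ∧ ν = s • EuclideanSpace.single i (1 : ℝ)

/-- `u` is an eigenfunction, with eigenvalue `lam`, of the Laplacian on the square with the
Robin condition `∂u/∂ν + h u = 0` on the boundary. Eigenfunctions of the square are smooth up to
the boundary, and boundary derivatives are taken within the closed square. Only the values of `u`
on the closed square matter. -/
structure IsRobinEigenfunction (h lam : ℝ) (u : Plane → ℝ) : Prop where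
  smooth : ContDiffOn ℝ ∞ u closedSquare
  nontrivial : ∃ z ∈ square, u z ≠ 0
  equation : ∀ z ∈ square, -(Laplacian.laplacian u z) = lam * u z
  robin : ∀ z ν, IsOutwardNormal z ν → fderivWithin ℝ u closedSquare z ν + h * u z = 0

/-- The nodal domains of `u` in `U`: the connected components of `U` minus the zero set of `u`. -/
def nodalDomains (u : Plane → ℝ) (U : Set Plane) : Set (Set Plane) :=
  {C | ∃ z ∈ {w ∈ U | u w ≠ 0}, C = connectedComponentIn {w ∈ U | u w ≠ 0} z}

end RobinSquare

namespace RobinSquare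

open Set Filter Topology

/-! Let `x`, `y` be the distances to the two sides at `z₀`. Since `Φ` vanishes at the corner for `θ
= θ₀`, `h = 0`, the eigenvalue equation, extended by continuity, gives `Φ_xx = -Φ_yy = -σ` there,
with `σ ≠ 0`. Hence near the corner and for nearby parameters `σ Φ` satisfies `u'' - h u' < 0` along
`x`, and `-σ Φ` does along `y`. The Robin condition says that `u' - h u` vanishes on the side, so
`u' - h u` becomes negative inside and `e^{-ht} u` decreases (`strictAntiOn_exp_mul`).

So positivity of `σ Φ` survives decreasing `x` and, within the disc, increasing `y`; negativity
survives the opposite moves. This makes both sign sets connected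
(`isPreconnected_of_left_of_vertical`). Neither is empty: at `(θ₀, 0)` a point of the diagonal is a
zero, strict monotonicity gives the two signs on either side of it, and these persist under small
perturbation. -/

/-! ### Connectedness, a one-dimensional monotonicity criterion, and counting components -/

/-- A planar set that is closed under moving left (within `x > 0`) and has order-connected vertical
sections is connected. -/
theorem isPreconnected_of_left_of_vertical {P : Set (ℝ × ℝ)}
    (hleft : ∀ x y x', (x, y) ∈ P → 0 < x' → x' ≤ x → (x', y) ∈ P)
    (hvert : ∀ x y y' y'', (x, y) ∈ P → (x, y'') ∈ P → y ≤ y' → y' ≤ y'' → (x, y') ∈ P)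
    (hpos : ∀ q ∈ P, 0 < q.1) : IsPreconnected P := by
  have key : ∀ x y x', (x, y) ∈ P → 0 < x' → x' ≤ x → JoinedIn P (x, y) (x', y) := by
    intro x y x' h hx' hle
    refine JoinedIn.of_segment_subset ?_
    rw [segment_symm, ← Prod.image_mk_segment_left, segment_eq_Icc hle]
    rintro _ ⟨t, ht, rfl⟩
    exact hleft x y t h (hx'.trans_le ht.1) ht.2
  have keyv : ∀ x y y', (x, y) ∈ P → (x, y') ∈ P → JoinedIn P (x, y) (x, y') := by
    intro x y y' h h'
    refine JoinedIn.of_segment_subset ?_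
    rw [← Prod.image_mk_segment_right, segment_eq_uIcc]
    rintro _ ⟨t, ht, rfl⟩
    rcases le_total y y' with hyy | hyy
    · rw [uIcc_of_le hyy] at ht
      exact hvert x y t y' h h' ht.1 ht.2
    · rw [uIcc_of_ge hyy] at ht
      exact hvert x y' t y h' h ht.1 ht.2
  have joined : ∀ p ∈ P, ∀ q ∈ P, JoinedIn P p q := by
    rintro ⟨x, y⟩ hp ⟨x', y'⟩ hq
    -- Both points slide left to this common abscissa and are joined there by a vertical segment.
    have hm : 0 < min x x' := lt_min (hpos _ hp) (hpos _ hq)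
    exact ((key x y _ hp hm (min_le_left _ _)).trans
      (keyv _ y y' (hleft _ _ _ hp hm (min_le_left _ _)) (hleft _ _ _ hq hm (min_le_right _ _)))).trans
      (key x' y' _ hq hm (min_le_right _ _)).symm
  rcases P.eq_empty_or_nonempty with rfl | ⟨p, hp⟩
  · exact isPreconnected_empty
  · exact (IsPathConnected.isConnected ⟨p, hp, fun {q} hq => joined p hp q hq⟩).isPreconnected

/-- If `u' - h u` vanishes at `0` and decreases, then `e^{-ht} u` decreases. -/
theorem strictAntiOn_exp_mul {u u' u'' : ℝ → ℝ} {h T : ℝ}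
    (hu : ∀ t ∈ Icc 0 T, HasDerivWithinAt u (u' t) (Icc 0 T) t)
    (hu' : ∀ t ∈ Icc 0 T, HasDerivWithinAt u' (u'' t) (Icc 0 T) t)
    (h0 : u' 0 = h * u 0) (hneg : ∀ t ∈ Icc 0 T, u'' t - h * u' t < 0) :
    StrictAntiOn (fun t => Real.exp (-h * t) * u t) (Icc 0 T) := by
  have hv : StrictAntiOn (fun t => u' t - h * u t) (Icc 0 T) := by
    refine strictAntiOn_of_deriv_neg (convex_Icc _ _) (fun t ht =>
      ((hu' t ht).sub ((hu t ht).const_mul h)).continuousWithinAt) fun t ht => ?_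
    rw [interior_Icc] at ht
    have ht' := Ioo_subset_Icc_self ht
    have hd := ((hu' t ht').sub ((hu t ht').const_mul h)).hasDerivAt (Icc_mem_nhds ht.1 ht.2)
    exact hd.deriv.trans_lt (hneg t ht')
  have hexp : ∀ t, HasDerivAt (fun t => Real.exp (-h * t)) (Real.exp (-h * t) * -h) t := fun t => by
    simpa using ((hasDerivAt_id t).const_mul (-h)).exp
  refine strictAntiOn_of_deriv_neg (convex_Icc _ _) (fun t ht =>
      ((hexp t).hasDerivWithinAt.mul (hu t ht)).continuousWithinAt) fun t ht => ?_
  rw [interior_Icc] at ht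
  have ht' := Ioo_subset_Icc_self ht
  have hd := ((hexp t).mul ((hu t ht').hasDerivAt (Icc_mem_nhds ht.1 ht.2)))
  refine hd.deriv.trans_lt ?_
  have h1 := hv (left_mem_Icc.2 (ht.1.le.trans ht.2.le)) ht' ht.1
  simp only [h0, sub_self] at h1
  have : Real.exp (-h * t) * -h * u t + Real.exp (-h * t) * u' t
      = Real.exp (-h * t) * (u' t - h * u t) := by ring
  rw [this]
  exact mul_neg_of_pos_of_neg (Real.exp_pos _) h1

/-- Two nonempty connected sets on which a continuous function is positive, respectively negative,
are the nodal domains. -/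
theorem ncard_nodalDomains_eq_two {u : Plane → ℝ} {U : Set Plane} (hu : ContinuousOn u U)
    (hP : IsConnected {w ∈ U | 0 < u w}) (hN : IsConnected {w ∈ U | u w < 0}) :
    (nodalDomains u U).ncard = 2 := by
  -- A sign change inside one component would force a zero there, by the intermediate value theorem.
  have side : ∀ z ∈ U, ∀ w ∈ connectedComponentIn {w ∈ U | u w ≠ 0} z, u z ≠ 0 →
      0 < u z * u w := by
    intro z hz w hw hne
    have hsub := connectedComponentIn_subset {w ∈ U | u w ≠ 0} z
    have him : IsPreconnected (u '' connectedComponentIn {w ∈ U | u w ≠ 0} z) :=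
      isPreconnected_connectedComponentIn.image u (hu.mono fun x hx => (hsub hx).1)
    have hz' := mem_image_of_mem u (mem_connectedComponentIn (x := z) (F := {w ∈ U | u w ≠ 0})
      ⟨hz, hne⟩)
    have hw' := mem_image_of_mem u hw
    by_contra hcon
    have hoc := him.ordConnected.uIcc_subset hz' hw'
    obtain ⟨x, hx, hx0⟩ := hoc (show (0 : ℝ) ∈ uIcc (u z) (u w) by
      rw [mem_uIcc]
      by_contra! h
      rcases lt_or_gt_of_ne hne with h1 | h1
      · exact hcon (mul_pos_of_neg_of_neg h1 (h.1 h1.le))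
      · exact hcon (mul_pos h1 (lt_of_not_ge fun h2 => by linarith [h.2 h2])))
    exact (hsub hx).2 hx0
  have hPc : ∀ z ∈ {w ∈ U | 0 < u w},
      connectedComponentIn {w ∈ U | u w ≠ 0} z = {w ∈ U | 0 < u w} := by
    intro z hz
    refine Subset.antisymm (fun w hw => ⟨(connectedComponentIn_subset _ _ hw).1, ?_⟩)
      (hP.isPreconnected.subset_connectedComponentIn hz fun w hw => ⟨hw.1, hw.2.ne'⟩)
    exact (pos_iff_pos_of_mul_pos (side z hz.1 w hw hz.2.ne')).1 hz.2
  have hNc : ∀ z ∈ {w ∈ U | u w < 0},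
      connectedComponentIn {w ∈ U | u w ≠ 0} z = {w ∈ U | u w < 0} := by
    intro z hz
    refine Subset.antisymm (fun w hw => ⟨(connectedComponentIn_subset _ _ hw).1, ?_⟩)
      (hN.isPreconnected.subset_connectedComponentIn hz fun w hw => ⟨hw.1, hw.2.ne⟩)
    exact (neg_iff_neg_of_mul_pos (side z hz.1 w hw hz.2.ne)).1 hz.2
  have : nodalDomains u U = {{w ∈ U | 0 < u w}, {w ∈ U | u w < 0}} := by
    ext C
    constructor
    · rintro ⟨z, ⟨hzU, hz0⟩, rfl⟩
      rcases lt_or_gt_of_ne hz0 with h | h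
      · exact Or.inr (hNc z ⟨hzU, h⟩)
      · exact Or.inl (hPc z ⟨hzU, h⟩)
    · rintro (rfl | rfl)
      · obtain ⟨z, hz⟩ := hP.nonempty
        exact ⟨z, ⟨hz.1, hz.2.ne'⟩, (hPc z hz).symm⟩
      · obtain ⟨z, hz⟩ := hN.nonempty
        exact ⟨z, ⟨hz.1, hz.2.ne⟩, (hNc z hz).symm⟩
  rw [this, ncard_pair]
  intro heq
  obtain ⟨z, hz⟩ := hP.nonempty
  have hz' : z ∈ {w ∈ U | u w < 0} := heq ▸ hz
  exact lt_asymm hz.2 hz'.2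

/-! ### Derivatives up to the boundary -/

theorem isOpen_square : IsOpen square := by
  have : square = ⋂ i : Fin 2, {z : Plane | |z i| < Real.pi / 2} := by ext; simp [square]
  rw [this]
  exact isOpen_iInter_of_finite fun i => isOpen_lt (by fun_prop) continuous_const

theorem square_subset_closedSquare : square ⊆ closedSquare := fun _ hz i => (hz i).le

theorem uniqueDiffOn_closedSquare : UniqueDiffOn ℝ closedSquare := by
  have hconv : Convex ℝ closedSquare := by
    have : closedSquare = ⋂ i : Fin 2, (EuclideanSpace.proj i : Plane →L[ℝ] ℝ) ⁻¹'
        Icc (-(Real.pi / 2)) (Real.pi / 2) := by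
      ext; simp [closedSquare, abs_le]
    rw [this]
    exact convex_iInter fun i =>
      (convex_Icc _ _).linear_preimage (EuclideanSpace.proj i : Plane →L[ℝ] ℝ).toLinearMap
  refine uniqueDiffOn_convex hconv ⟨0, ?_⟩
  exact interior_mono square_subset_closedSquare (isOpen_square.interior_eq.symm ▸ fun i => by
    simpa using Real.pi_div_two_pos)

/-- The domain of the family near the corner `z₀`. -/
def cornerDomain (z₀ : Plane) (θ₀ h₀ ε η : ℝ) : Set (Plane × ℝ × ℝ) :=
  (closedSquare ∩ Metric.ball z₀ ε) ×ˢ (Ioo (θ₀ - η) (θ₀ + η) ×ˢ Ico 0 h₀)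

theorem uniqueDiffOn_cornerDomain (z₀ : Plane) (θ₀ h₀ ε η : ℝ) :
    UniqueDiffOn ℝ (cornerDomain z₀ θ₀ h₀ ε η) :=
  (uniqueDiffOn_closedSquare.inter Metric.isOpen_ball).prod
    ((uniqueDiffOn_Ioo _ _).prod (uniqueDiffOn_Ico _ _))

/-- The directional derivative of `g` within `K`. -/
noncomputable def dirDeriv {E : Type*} [NormedAddCommGroup E] [NormedSpace ℝ E] (K : Set E) (d : E)
    (g : E → ℝ) : E → ℝ :=
  fun p => fderivWithin ℝ g K p d

section DirDeriv

variable {E : Type*} [NormedAddCommGroup E] [NormedSpace ℝ E] {K : Set E} {g : E → ℝ}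

theorem contDiffOn_dirDeriv (hK : UniqueDiffOn ℝ K) (hg : ContDiffOn ℝ ∞ g K) (d : E) :
    ContDiffOn ℝ ∞ (dirDeriv K d g) K :=
  (hg.fderivWithin hK (by simp)).clm_apply contDiffOn_const

theorem hasDerivWithinAt_comp_dirDeriv (hg : ContDiffOn ℝ ∞ g K) {c : ℝ → E} {d : E} {I : Set ℝ}
    {t : ℝ} (hc : HasDerivAt c d t) (hmaps : MapsTo c I K) (ht : t ∈ I) :
    HasDerivWithinAt (fun t => g (c t)) (dirDeriv K d g (c t)) I t :=
  ((hg.differentiableOn (by simp)) (c t) (hmaps ht)).hasFDerivWithinAt.comp_hasDerivWithinAt t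
    hc.hasDerivWithinAt hmaps

end DirDeriv

variable {z₀ : Plane} {θ₀ h₀ ε η : ℝ}

/-- Trades derivatives in `z` at frozen parameters for directional derivatives of the joint
function, which are continuous in `(z, θ, h)` together; the perturbation argument needs this. -/
theorem fderivWithin_slice {g : Plane × ℝ × ℝ → ℝ}
    (hg : ContDiffOn ℝ ∞ g (cornerDomain z₀ θ₀ h₀ ε η)) {z : Plane} {τ : ℝ × ℝ}
    (hp : (z, τ) ∈ cornerDomain z₀ θ₀ h₀ ε η) (v : Plane) :
    fderivWithin ℝ (fun z => g (z, τ)) closedSquare z v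
      = dirDeriv (cornerDomain z₀ θ₀ h₀ ε η) (v, 0) g (z, τ) := by
  have hz : z ∈ closedSquare ∩ Metric.ball z₀ ε := hp.1
  have h1 : HasFDerivWithinAt (fun z : Plane => (z, τ))
      ((ContinuousLinearMap.id ℝ Plane).prod (0 : Plane →L[ℝ] ℝ × ℝ))
      (closedSquare ∩ Metric.ball z₀ ε) z :=
    (hasFDerivWithinAt_id _ _).prodMk (hasFDerivWithinAt_const _ _ _)
  have h2 := HasFDerivWithinAt.comp z ((hg.differentiableOn (by simp)) (z, τ) hp).hasFDerivWithinAt h1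
    (t := cornerDomain z₀ θ₀ h₀ ε η) (fun w hw => ⟨hw, hp.2⟩)
  have h3 := h2.fderivWithin ((uniqueDiffOn_closedSquare.inter Metric.isOpen_ball) z hz)
  rw [fderivWithin_inter (Metric.isOpen_ball.mem_nhds hz.2)] at h3
  change fderivWithin ℝ (g ∘ fun z => (z, τ)) closedSquare z v = _
  rw [h3]
  simp [dirDeriv]

theorem iteratedFDerivWithin_slice {g : Plane × ℝ × ℝ → ℝ}
    (hg : ContDiffOn ℝ ∞ g (cornerDomain z₀ θ₀ h₀ ε η)) {z : Plane} {τ : ℝ × ℝ}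
    (hs : ContDiffOn ℝ ∞ (fun z => g (z, τ)) closedSquare)
    (hp : (z, τ) ∈ cornerDomain z₀ θ₀ h₀ ε η) (v : Plane) :
    iteratedFDerivWithin ℝ 2 (fun z => g (z, τ)) closedSquare z ![v, v]
      = dirDeriv (cornerDomain z₀ θ₀ h₀ ε η) (v, 0)
        (dirDeriv (cornerDomain z₀ θ₀ h₀ ε η) (v, 0) g) (z, τ) := by
  have hz : z ∈ closedSquare ∩ Metric.ball z₀ ε := hp.1
  rw [← fderivWithin_slice (contDiffOn_dirDeriv (uniqueDiffOn_cornerDomain _ _ _ _ _) hg _) hp,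
    iteratedFDerivWithin_two_apply _ uniqueDiffOn_closedSquare hz.1]
  have hev : (fun w => dirDeriv (cornerDomain z₀ θ₀ h₀ ε η) (v, 0) g (w, τ))
      =ᶠ[𝓝[closedSquare] z] fun w => fderivWithin ℝ (fun z => g (z, τ)) closedSquare w v := by
    filter_upwards [self_mem_nhdsWithin,
      mem_nhdsWithin_of_mem_nhds (Metric.isOpen_ball.mem_nhds hz.2)] with w hw hw'
    exact (fderivWithin_slice hg (z := w) (τ := τ) ⟨⟨hw, hw'⟩, hp.2⟩ v).symm
  rw [hev.fderivWithin_eq_of_mem hz.1]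
  have hd : DifferentiableWithinAt ℝ (fderivWithin ℝ (fun z => g (z, τ)) closedSquare)
      closedSquare z :=
    (hs.fderivWithin (m := ∞) uniqueDiffOn_closedSquare (by simp)).differentiableOn (by simp) z hz.1
  have := (hd.hasFDerivWithinAt.clm_apply (hasFDerivWithinAt_const v z closedSquare)).fderivWithin
    (uniqueDiffOn_closedSquare z hz.1)
  rw [this]
  simp

theorem laplacian_eq_dirDeriv {g : Plane × ℝ × ℝ → ℝ}
    (hg : ContDiffOn ℝ ∞ g (cornerDomain z₀ θ₀ h₀ ε η)) {z : Plane} {τ : ℝ × ℝ}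
    (hs : ContDiffOn ℝ ∞ (fun z => g (z, τ)) closedSquare)
    (hp : (z, τ) ∈ cornerDomain z₀ θ₀ h₀ ε η) (hz : z ∈ square) :
    Laplacian.laplacian (fun z => g (z, τ)) z
      = ∑ i : Fin 2, dirDeriv (cornerDomain z₀ θ₀ h₀ ε η) (EuclideanSpace.single i (1 : ℝ), 0)
        (dirDeriv (cornerDomain z₀ θ₀ h₀ ε η) (EuclideanSpace.single i (1 : ℝ), 0) g) (z, τ) := by
  have hmem : closedSquare ∈ 𝓝 z :=
    mem_of_superset (isOpen_square.mem_nhds hz) square_subset_closedSquare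
  rw [InnerProductSpace.laplacian_eq_iteratedFDeriv_orthonormalBasis _
    (EuclideanSpace.basisFun (Fin 2) ℝ)]
  refine Finset.sum_congr rfl fun i _ => ?_
  rw [← iteratedFDerivWithin_slice hg hs hp, iteratedFDerivWithin_eq_iteratedFDeriv
    uniqueDiffOn_closedSquare ((contDiffOn_infty.1 hs 2).contDiffAt hmem) hp.1.1]
  simp

/-! ### Inward coordinates at the corner -/

/-- The sign of the inward direction of the `i`-th axis at the corner `z₀`. -/
noncomputable def inwardSign (z₀ : Plane) (i : Fin 2) : ℝ := -z₀ i / (Real.pi / 2)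

/-- The point whose distances from the sides meeting at the corner `z₀` are `x 0` and `x 1`. -/
noncomputable def inward (z₀ : Plane) (x : Fin 2 → ℝ) : Plane :=
  WithLp.toLp 2 fun i => z₀ i + inwardSign z₀ i * x i

variable {r : ℝ}

theorem corner_eq (z₀ : Plane) (i : Fin 2) : z₀ i = -inwardSign z₀ i * (Real.pi / 2) := by
  have := Real.pi_pos
  unfold inwardSign
  field_simp

theorem inwardSign_eq (hz₀ : IsCorner z₀) (i : Fin 2) :
    inwardSign z₀ i = 1 ∨ inwardSign z₀ i = -1 := by
  have h1 := Real.pi_div_two_pos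
  rcases (abs_eq h1.le).1 (hz₀ i) with h | h
  · right; rw [inwardSign, h, neg_div, div_self h1.ne']
  · left; rw [inwardSign, h, neg_neg, div_self h1.ne']

theorem inwardSign_mul_self (hz₀ : IsCorner z₀) (i : Fin 2) :
    inwardSign z₀ i * inwardSign z₀ i = 1 := by
  rcases inwardSign_eq hz₀ i with h | h <;> simp [h]

theorem abs_inward (hz₀ : IsCorner z₀) (x : Fin 2 → ℝ) (i : Fin 2) :
    |inward z₀ x i| = |x i - Real.pi / 2| := by
  have : inward z₀ x i = inwardSign z₀ i * (x i - Real.pi / 2) := by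
    change z₀ i + inwardSign z₀ i * x i = _
    rw [corner_eq z₀ i]; ring
  rw [this, abs_mul]
  rcases inwardSign_eq hz₀ i with h | h <;> simp [h]

theorem abs_inward_lt (hz₀ : IsCorner z₀) {x : Fin 2 → ℝ} {i : Fin 2} (h0 : 0 < x i)
    (h1 : x i < 1) : |inward z₀ x i| < Real.pi / 2 := by
  rw [abs_inward hz₀, abs_lt]
  constructor <;> linarith [Real.pi_gt_three]

theorem abs_inward_le (hz₀ : IsCorner z₀) {x : Fin 2 → ℝ} {i : Fin 2} (h0 : 0 ≤ x i)
    (h1 : x i ≤ 1) : |inward z₀ x i| ≤ Real.pi / 2 := by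
  rw [abs_inward hz₀, abs_le]
  constructor <;> linarith [Real.pi_gt_three]

theorem inward_mem_ball (hz₀ : IsCorner z₀) {x : Fin 2 → ℝ} (hr : 0 < r) :
    inward z₀ x ∈ Metric.ball z₀ r ↔ x 0 ^ 2 + x 1 ^ 2 < r ^ 2 := by
  have h : ∀ i, dist (inward z₀ x i) (z₀ i) ^ 2 = x i ^ 2 := fun i => by
    rw [Real.dist_eq, sq_abs]
    change (z₀ i + inwardSign z₀ i * x i - z₀ i) ^ 2 = _
    linear_combination x i ^ 2 * inwardSign_mul_self hz₀ i
  rw [Metric.mem_ball, EuclideanSpace.dist_eq, Fin.sum_univ_two, h, h, Real.sqrt_lt' hr]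

theorem exists_inward_eq (hz₀ : IsCorner z₀) {z : Plane} (hz : z ∈ square) :
    ∃ x : Fin 2 → ℝ, inward z₀ x = z ∧ ∀ i, 0 < x i := by
  refine ⟨fun i => inwardSign z₀ i * z i + Real.pi / 2, ?_, fun i => ?_⟩
  · ext i
    change z₀ i + inwardSign z₀ i * (inwardSign z₀ i * z i + Real.pi / 2) = z i
    rw [corner_eq z₀ i]
    linear_combination z i * inwardSign_mul_self hz₀ i
  · have := abs_lt.1 (hz i)
    rcases inwardSign_eq hz₀ i with h | h <;> simp only [h] <;> linarith

theorem inward_zero : inward z₀ 0 = z₀ := by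
  ext i
  simp [inward]

theorem continuous_inward : Continuous (inward z₀) := by
  unfold inward
  fun_prop

theorem hasDerivAt_inward (x : Fin 2 → ℝ) (i : Fin 2) (θ h t : ℝ) :
    HasDerivAt (fun t => (inward z₀ (Function.update x i t), θ, h))
      (inwardSign z₀ i • ((EuclideanSpace.single i (1 : ℝ) : Plane), (0 : ℝ × ℝ))) t := by
  have h1 : ∀ t, inward z₀ (Function.update x i t)
      = inward z₀ (Function.update x i 0) + t • inwardSign z₀ i • EuclideanSpace.single i (1 : ℝ) := by
    intro t
    ext j
    by_cases hj : j = i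
    · subst hj; simp [inward]; ring
    · simp [inward, hj]
  have h2 := ((hasDerivAt_id t).smul_const
    (inwardSign z₀ i • (EuclideanSpace.single i (1 : ℝ) : Plane))).const_add
    (inward z₀ (Function.update x i 0))
  rw [one_smul] at h2
  have h3 := h2.prodMk (hasDerivAt_const t (θ, h))
  rw [Prod.smul_mk, smul_zero]
  exact (funext fun t => Prod.ext (h1 t) rfl :
    (fun t => (inward z₀ (Function.update x i t), θ, h)) = fun t =>
      (inward z₀ (Function.update x i 0) + t • inwardSign z₀ i • EuclideanSpace.single i (1 : ℝ),
        θ, h)) ▸ h3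

/-! ### Monotonicity along inward segments -/

/-- Along inward segments issuing from a side near the corner, `e^{-ht} Φ` is strictly monotone,
provided that the second normal derivative has a sign up to terms of order `h`. -/
theorem strictAntiOn_exp_mul_inward (hz₀ : IsCorner z₀) {g : Plane × ℝ × ℝ → ℝ}
    (hg : ContDiffOn ℝ ∞ g (cornerDomain z₀ θ₀ h₀ ε η)) {θ h lam σ : ℝ}
    (hτ : (θ, h) ∈ Ioo (θ₀ - η) (θ₀ + η) ×ˢ Ico 0 h₀)
    (heig : IsRobinEigenfunction h lam fun z => g (z, θ, h))
    (hr : 0 < r) (hr1 : r ≤ 1) (hrε : r ≤ ε) (i : Fin 2)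
    (hsign : ∀ z ∈ closedSquare ∩ Metric.ball z₀ r,
      σ * (dirDeriv (cornerDomain z₀ θ₀ h₀ ε η) (EuclideanSpace.single i (1 : ℝ), 0)
          (dirDeriv (cornerDomain z₀ θ₀ h₀ ε η) (EuclideanSpace.single i (1 : ℝ), 0) g) (z, θ, h)
        - h * (inwardSign z₀ i * dirDeriv (cornerDomain z₀ θ₀ h₀ ε η)
          (EuclideanSpace.single i (1 : ℝ), 0) g (z, θ, h))) < 0)
    {x : Fin 2 → ℝ} (hx : ∀ j, 0 < x j) (hxr : x 0 ^ 2 + x 1 ^ 2 < r ^ 2) :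
    StrictAntiOn (fun t => Real.exp (-h * t) * (σ * g (inward z₀ (Function.update x i t), θ, h)))
      (Icc 0 (x i)) := by
  set K := cornerDomain z₀ θ₀ h₀ ε η with hKdef
  set e : Plane × ℝ × ℝ := (EuclideanSpace.single i (1 : ℝ), 0) with he
  set a := inwardSign z₀ i with ha
  have hx1 : ∀ j, x j < 1 := by
    intro j
    have h1 : x 0 ^ 2 < 1 := by nlinarith [sq_nonneg (x 1)]
    have h2 : x 1 ^ 2 < 1 := by nlinarith [sq_nonneg (x 0)]
    fin_cases j
    · exact (abs_lt.1 ((sq_lt_one_iff_abs_lt_one _).1 h1)).2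
    · exact (abs_lt.1 ((sq_lt_one_iff_abs_lt_one _).1 h2)).2
  have hball : ∀ t ∈ Icc 0 (x i),
      inward z₀ (Function.update x i t) ∈ closedSquare ∩ Metric.ball z₀ r := by
    intro t ht
    refine ⟨fun j => abs_inward_le hz₀ ?_ ?_, (inward_mem_ball hz₀ hr).2 (lt_of_le_of_lt ?_ hxr)⟩
    · by_cases hj : j = i
      · subst hj; simpa using ht.1
      · simpa [hj] using (hx j).le
    · by_cases hj : j = i
      · subst hj; simpa using ht.2.trans (hx1 j).le
      · simpa [hj] using (hx1 j).le
    · have hle : ∀ j, Function.update x i t j ^ 2 ≤ x j ^ 2 := by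
        intro j
        by_cases hj : j = i
        · subst hj; simpa using pow_le_pow_left₀ ht.1 ht.2 2
        · simp [hj]
      exact add_le_add (hle 0) (hle 1)
  have hmaps : MapsTo (fun t => (inward z₀ (Function.update x i t), θ, h)) (Icc 0 (x i)) K :=
    fun t ht => ⟨⟨(hball t ht).1, Metric.ball_subset_ball hrε (hball t ht).2⟩, hτ⟩
  have hlin : ∀ f p, dirDeriv K (a • e) f p = a * dirDeriv K e f p := fun f p => by
    simp [dirDeriv]
  refine strictAntiOn_exp_mul
    (u' := fun t => σ * (a * dirDeriv K e g (inward z₀ (Function.update x i t), θ, h)))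
    (u'' := fun t => σ * dirDeriv K e (dirDeriv K e g) (inward z₀ (Function.update x i t), θ, h))
    (fun t ht => ?_) (fun t ht => ?_) ?_ fun t ht => ?_
  · have := hasDerivWithinAt_comp_dirDeriv hg (hasDerivAt_inward x i θ h t) hmaps ht
    rw [hlin] at this
    exact this.const_mul σ
  · have := hasDerivWithinAt_comp_dirDeriv
      (contDiffOn_dirDeriv (uniqueDiffOn_cornerDomain _ _ _ _ _) hg e)
      (hasDerivAt_inward x i θ h t) hmaps ht
    rw [hlin] at this
    -- The two orientation factors `a = ±1` cancel in the second derivative.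
    have := (this.const_mul a).const_mul σ
    rwa [← mul_assoc a, inwardSign_mul_self hz₀, one_mul] at this
  · have h0 := left_mem_Icc.2 (hx i).le
    -- At the foot of the segment the outward normal is `-a` times the axis vector, so the Robin
    -- condition reads `u'(0) = h u(0)` in the inward variable.
    have hrob := heig.robin (inward z₀ (Function.update x i 0))
      (-a • EuclideanSpace.single i (1 : ℝ)) ⟨i, -a, ?_, ?_, fun j hj => ?_, rfl⟩
    · rw [map_smul, fderivWithin_slice hg (hmaps h0), smul_eq_mul] at hrob
      linear_combination (-σ) * hrob
    · rcases inwardSign_eq hz₀ i with h | h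
      · exact Or.inr (by rw [ha, h])
      · exact Or.inl (by rw [ha, h, neg_neg])
    · rw [← corner_eq]
      simp [inward]
    · refine abs_inward_lt hz₀ ?_ ?_
      · simpa [hj] using hx j
      · simpa [hj] using hx1 j
  · have := hsign _ (hball t ht)
    linarith

/-! ### From monotonicity to two nodal domains -/

/-- Moving left never leaves the quarter disc, but moving up can. In a vertical section the lower
point supplies positivity and the upper one only keeps the intermediate point in the disc. -/
theorem isPreconnected_pos_of_monotone {f : ℝ × ℝ → ℝ}
    (hleft : ∀ x y x', 0 < x' → x' < x → 0 < y → x ^ 2 + y ^ 2 < r ^ 2 →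
      0 < f (x, y) → 0 < f (x', y))
    (hup : ∀ x y y', 0 < x → 0 < y → y < y' → x ^ 2 + y' ^ 2 < r ^ 2 →
      0 < f (x, y) → 0 < f (x, y')) :
    IsPreconnected {q : ℝ × ℝ | (0 < q.1 ∧ 0 < q.2 ∧ q.1 ^ 2 + q.2 ^ 2 < r ^ 2) ∧ 0 < f q} := by
  refine isPreconnected_of_left_of_vertical ?_ ?_ fun q hq => hq.1.1
  · rintro x y x' ⟨⟨h1, h2, h3⟩, h4⟩ hx' hle
    simp only at h1 h2 h3
    refine ⟨⟨hx', h2, ?_⟩, ?_⟩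
    · simp only; nlinarith
    · rcases hle.eq_or_lt with rfl | hlt
      · exact h4
      · exact hleft x y x' hx' hlt h2 h3 h4
  · rintro x y y' y'' ⟨⟨h1, h2, h3⟩, h4⟩ ⟨⟨h1', h2', h3'⟩, h4'⟩ hle hle'
    simp only at h1 h2 h3 h2' h3'
    have h5 : x ^ 2 + y' ^ 2 < r ^ 2 := by nlinarith
    refine ⟨⟨h1, h2.trans_le hle, h5⟩, ?_⟩
    rcases hle.eq_or_lt with rfl | hlt
    · exact h4
    · exact hup x y y' h1 h2 hlt h5 h4

/-- A function near the corner that decreases in one coordinate and increases in the other, up to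
positive factors, and takes both signs, has two nodal domains. -/
theorem ncard_nodalDomains_corner (hz₀ : IsCorner z₀) (hr : 0 < r) (hr1 : r ≤ 1) {u : Plane → ℝ}
    {h : ℝ} (hu : ContinuousOn u (Metric.ball z₀ r ∩ square))
    (hX : ∀ x : Fin 2 → ℝ, (∀ j, 0 < x j) → x 0 ^ 2 + x 1 ^ 2 < r ^ 2 →
      StrictAntiOn (fun t => Real.exp (-h * t) * u (inward z₀ (Function.update x 0 t)))
        (Icc 0 (x 0)))
    (hY : ∀ x : Fin 2 → ℝ, (∀ j, 0 < x j) → x 0 ^ 2 + x 1 ^ 2 < r ^ 2 →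
      StrictAntiOn (fun t => Real.exp (-h * t) * -u (inward z₀ (Function.update x 1 t)))
        (Icc 0 (x 1)))
    (hpos : ∃ z ∈ Metric.ball z₀ r ∩ square, 0 < u z)
    (hneg : ∃ z ∈ Metric.ball z₀ r ∩ square, u z < 0) :
    (nodalDomains u (Metric.ball z₀ r ∩ square)).ncard = 2 := by
  have hup0 : ∀ x y t : ℝ, Function.update ![x, y] 0 t = ![t, y] := fun x y t => by
    ext j; fin_cases j <;> simp
  have hup1 : ∀ x y t : ℝ, Function.update ![x, y] 1 t = ![x, t] := fun x y t => by
    ext j; fin_cases j <;> simp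
  have hX' : ∀ x y x', 0 < x' → x' < x → 0 < y → x ^ 2 + y ^ 2 < r ^ 2 →
      Real.exp (-h * x) * u (inward z₀ ![x, y]) < Real.exp (-h * x') * u (inward z₀ ![x', y]) := by
    intro x y x' hx' hlt hy hq
    have := hX ![x, y] (by simp [Fin.forall_fin_two, hx'.trans hlt, hy]) (by simpa using hq)
      (a := x') (b := x) ⟨hx'.le, by simpa using hlt.le⟩
      ⟨(hx'.trans hlt).le, by simp⟩ hlt
    simpa only [hup0] using this
  have hY' : ∀ x y y', 0 < x → 0 < y → y < y' → x ^ 2 + y' ^ 2 < r ^ 2 →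
      Real.exp (-h * y) * u (inward z₀ ![x, y]) < Real.exp (-h * y') * u (inward z₀ ![x, y']) := by
    intro x y y' hx hy hlt hq
    have := hY ![x, y'] (by simp [Fin.forall_fin_two, hx, hy.trans hlt]) (by simpa using hq)
      (a := y) (b := y') ⟨hy.le, by simpa using hlt.le⟩
      ⟨(hy.trans hlt).le, by simp⟩ hlt
    simp only [hup1] at this
    linarith
  set J : ℝ × ℝ → Plane := fun q => inward z₀ ![q.1, q.2] with hJ
  have hJc : Continuous J := continuous_inward.comp (by fun_prop)
  have hU : ∀ p : Plane → Prop, {w ∈ Metric.ball z₀ r ∩ square | p w}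
      = J '' {q | (0 < q.1 ∧ 0 < q.2 ∧ q.1 ^ 2 + q.2 ^ 2 < r ^ 2) ∧ p (J q)} := by
    intro p
    ext w
    constructor
    · rintro ⟨⟨hw1, hw2⟩, hp⟩
      obtain ⟨x, rfl, hx⟩ := exists_inward_eq hz₀ hw2
      have hxe : x = ![x 0, x 1] := by ext j; fin_cases j <;> rfl
      refine ⟨(x 0, x 1), ⟨⟨hx 0, hx 1, (inward_mem_ball hz₀ hr).1 hw1⟩, ?_⟩, ?_⟩
      · simp only [hJ]; rwa [← hxe]
      · simp only [hJ]; rw [← hxe]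
    · rintro ⟨⟨x, y⟩, ⟨⟨h1, h2, h3⟩, hp⟩, rfl⟩
      simp only at h1 h2 h3
      refine ⟨⟨(inward_mem_ball hz₀ hr).2 (by simpa using h3), fun j => abs_inward_lt hz₀ ?_ ?_⟩, hp⟩
      · fin_cases j <;> simpa
      · fin_cases j
        · simp only [Fin.zero_eta, Matrix.cons_val_zero]; nlinarith
        · simp only [Fin.mk_one, Matrix.cons_val_one, Matrix.cons_val_fin_one]; nlinarith
  refine ncard_nodalDomains_eq_two hu ⟨hpos, ?_⟩ ⟨hneg, ?_⟩
  · rw [hU]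
    refine (isPreconnected_pos_of_monotone (f := fun q => u (J q)) ?_ ?_).image J hJc.continuousOn
    · intro x y x' hx' hlt hy hq hf
      exact pos_of_mul_pos_right ((mul_pos (Real.exp_pos _) hf).trans (hX' x y x' hx' hlt hy hq))
        (Real.exp_pos _).le
    · intro x y y' hx hy hlt hq hf
      exact pos_of_mul_pos_right ((mul_pos (Real.exp_pos _) hf).trans (hY' x y y' hx hy hlt hq))
        (Real.exp_pos _).le
  · rw [hU]
    -- For `-u` the two coordinates exchange roles, so the criterion applies after a swap.
    have := isPreconnected_pos_of_monotone (r := r) (f := fun q => -u (J q.swap)) ?_ ?_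
    · convert this.image (J ∘ Prod.swap) (hJc.comp continuous_swap).continuousOn using 1
      rw [image_comp]
      congr 1
      rw [image_swap_eq_preimage_swap]
      ext ⟨x, y⟩
      simp [add_comm, and_left_comm]
    · intro x y x' hx' hlt hy hq hf
      have := hY' y x' x hy hx' hlt (by linarith)
      have h2 := mul_pos (Real.exp_pos (-h * x)) hf
      simp only [hJ, Prod.swap_prod_mk] at h2 ⊢
      exact pos_of_mul_pos_right (a := Real.exp (-h * x')) (by linarith) (Real.exp_pos _).le
    · intro x y y' hx hy hlt hq hf
      have := hX' y' x y hy hlt hx (by linarith)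
      have h2 := mul_pos (Real.exp_pos (-h * y)) hf
      simp only [hJ, Prod.swap_prod_mk] at h2 ⊢
      exact pos_of_mul_pos_right (a := Real.exp (-h * y')) (by linarith) (Real.exp_pos _).le

/-! ### The equation at the corner -/

/-- At the corner the pure second derivatives of an eigenfunction vanishing there cancel. -/
theorem sum_dirDeriv_corner (hz₀ : IsCorner z₀) {g : Plane × ℝ × ℝ → ℝ} (hε : 0 < ε)
    (hg : ContDiffOn ℝ ∞ g (cornerDomain z₀ θ₀ h₀ ε η)) {τ : ℝ × ℝ} {h lam : ℝ}
    (hτ : τ ∈ Ioo (θ₀ - η) (θ₀ + η) ×ˢ Ico 0 h₀)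
    (heig : IsRobinEigenfunction h lam fun z => g (z, τ)) (h0 : g (z₀, τ) = 0) :
    ∑ i : Fin 2, dirDeriv (cornerDomain z₀ θ₀ h₀ ε η) (EuclideanSpace.single i (1 : ℝ), 0)
        (dirDeriv (cornerDomain z₀ θ₀ h₀ ε η) (EuclideanSpace.single i (1 : ℝ), 0) g) (z₀, τ)
      = 0 := by
  set K := cornerDomain z₀ θ₀ h₀ ε η with hK
  have hcont : ContinuousOn (fun p => (∑ i : Fin 2, dirDeriv K (EuclideanSpace.single i (1 : ℝ), 0)
      (dirDeriv K (EuclideanSpace.single i (1 : ℝ), 0) g) p) + lam * g p) K :=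
    (continuousOn_finsetSum _ fun i _ => (contDiffOn_dirDeriv (uniqueDiffOn_cornerDomain _ _ _ _ _)
      (contDiffOn_dirDeriv (uniqueDiffOn_cornerDomain _ _ _ _ _) hg _) _).continuousOn).add
      (hg.continuousOn.const_mul lam)
  have hzc : z₀ ∈ closedSquare := fun i => (hz₀ i).le
  have hp : (z₀, τ) ∈ K := ⟨⟨hzc, Metric.mem_ball_self hε⟩, hτ⟩
  -- The equation holds only in the open square, so the corner is approached along the inward
  -- diagonal and the limit is taken by continuity.
  have hpath : Tendsto (fun t : ℝ => (inward z₀ fun _ => t, τ)) (𝓝[>] 0) (𝓝 (z₀, τ)) := by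
    have hc : Continuous fun t : ℝ => (inward z₀ fun _ => t, τ) :=
      (continuous_inward.comp (by fun_prop)).prodMk continuous_const
    have h1 := hc.tendsto 0
    have h2 : inward z₀ (fun _ => (0 : ℝ)) = z₀ := inward_zero
    rw [h2] at h1
    exact h1.mono_left nhdsWithin_le_nhds
  have hsq : ∀ᶠ t : ℝ in 𝓝[>] 0, (inward z₀ fun _ => t) ∈ square := by
    filter_upwards [Ioo_mem_nhdsGT one_pos] with t ht
    exact fun i => abs_inward_lt hz₀ ht.1 ht.2
  have hball : ∀ᶠ t : ℝ in 𝓝[>] 0, (inward z₀ fun _ => t) ∈ Metric.ball z₀ ε :=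
    ((continuous_fst.tendsto _).comp hpath).eventually (Metric.ball_mem_nhds z₀ hε)
  have hmem : ∀ᶠ t : ℝ in 𝓝[>] 0, (inward z₀ fun _ => t, τ) ∈ K := by
    filter_upwards [hsq, hball] with t h1 h2
    exact ⟨⟨square_subset_closedSquare h1, h2⟩, hτ⟩
  have hlim := (hcont _ hp).tendsto.comp (tendsto_nhdsWithin_iff.2 ⟨hpath, hmem⟩)
  have hzero := hlim.congr' (f₂ := fun _ => 0) (by
    filter_upwards [hsq, hmem] with t h1 h2
    have h3 := heig.equation _ h1
    rw [laplacian_eq_dirDeriv hg heig.smooth h2 h1] at h3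
    simp only [Function.comp_apply]
    linarith)
  have := tendsto_nhds_unique hzero tendsto_const_nhds
  rw [h0] at this
  linarith

/-! ### Perturbation from the reference parameters and conclusion -/

theorem exists_pos_forall_lt_zero {K : Set (Plane × ℝ × ℝ)} {F : Plane × ℝ × ℝ → ℝ} {z : Plane}
    (hF : ContinuousOn F K) (hp : (z, θ₀, 0) ∈ K) (hneg : F (z, θ₀, 0) < 0) :
    ∃ δ > 0, ∀ w θ h, dist w z < δ → |θ - θ₀| < δ → |h| < δ → (w, θ, h) ∈ K → F (w, θ, h) < 0 := by
  have h1 : {p | F p < 0} ∈ 𝓝[K] (z, θ₀, 0) := (hF _ hp).eventually_lt_const hneg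
  obtain ⟨δ, hδ, hsub⟩ := Metric.mem_nhdsWithin_iff.1 h1
  refine ⟨δ, hδ, fun w θ h hw hθ hh hK => hsub ⟨?_, hK⟩⟩
  rw [Metric.mem_ball, Prod.dist_eq, Prod.dist_eq]
  simpa [Real.dist_eq] using ⟨hw, hθ, hh⟩

theorem nodalDomains_const_mul {σ : ℝ} (hσ : σ ≠ 0) (u : Plane → ℝ) (U : Set Plane) :
    nodalDomains (fun z => σ * u z) U = nodalDomains u U := by
  simp [nodalDomains, hσ]

theorem exists_ncard_nodalDomains_eq_two (hz₀ : IsCorner z₀) {g : Plane × ℝ × ℝ → ℝ} {lam : ℝ → ℝ}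
    (hh₀ : 0 < h₀) (hε : 0 < ε) (hη : 0 < η)
    (hg : ContDiffOn ℝ ∞ g (cornerDomain z₀ θ₀ h₀ ε η))
    (heigen : ∀ θ ∈ Ioo (θ₀ - η) (θ₀ + η), ∀ h ∈ Ico 0 h₀,
      IsRobinEigenfunction h (lam h) fun z => g (z, θ, h))
    (hdiag : ∀ h ∈ Ico 0 h₀, ∀ t ∈ Icc (-1 : ℝ) 1, g (t • z₀, θ₀, h) = 0)
    (hyy : iteratedFDerivWithin ℝ 2 (fun z => g (z, θ₀, 0)) closedSquare z₀
      ![EuclideanSpace.single 1 1, EuclideanSpace.single 1 1] ≠ 0) :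
    ∃ ε₀ η₀ : ℝ, 0 < ε₀ ∧ ε₀ < ε ∧ 0 < η₀ ∧ η₀ < η ∧ η₀ < h₀ ∧
      ∀ θ h : ℝ, 0 ≤ h → |θ - θ₀| + h ≤ η₀ →
        (nodalDomains (fun z => g (z, θ, h)) (Metric.ball z₀ ε₀ ∩ square)).ncard = 2 := by
  set K := cornerDomain z₀ θ₀ h₀ ε η with hK
  have hKu : UniqueDiffOn ℝ K := uniqueDiffOn_cornerDomain _ _ _ _ _
  have hzc : z₀ ∈ closedSquare := fun i => (hz₀ i).le
  have hτ₀ : ((θ₀, 0) : ℝ × ℝ) ∈ Ioo (θ₀ - η) (θ₀ + η) ×ˢ Ico 0 h₀ :=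
    ⟨⟨by linarith, by linarith⟩, le_rfl, hh₀⟩
  have hp : (z₀, θ₀, 0) ∈ K := ⟨⟨hzc, Metric.mem_ball_self hε⟩, hτ₀⟩
  have heig₀ := heigen θ₀ hτ₀.1 0 hτ₀.2
  let e : Fin 2 → Plane × ℝ × ℝ := fun i => (EuclideanSpace.single i (1 : ℝ), 0)
  have hsum := sum_dirDeriv_corner hz₀ hε hg hτ₀ heig₀ (by
    simpa using hdiag 0 hτ₀.2 1 (by norm_num))
  rw [Fin.sum_univ_two] at hsum
  rw [iteratedFDerivWithin_slice hg heig₀.smooth hp] at hyy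
  set σ := dirDeriv K (e 1) (dirDeriv K (e 1) g) (z₀, θ₀, 0) with hσ
  have hσ0 : dirDeriv K (e 0) (dirDeriv K (e 0) g) (z₀, θ₀, 0) = -σ := by
    simp only [hσ, e]; linarith
  have hσne : σ ≠ 0 := hyy
  have hσpos : 0 < σ * σ := mul_self_pos.2 hσne
  -- At `(z₀, θ₀, 0)` the `h` term drops out, and both choices used below (`i = 0`, `s = σ` and `i =
  -- 1`, `s = -σ`) give `-σ²`.
  have hcontF : ∀ (i : Fin 2) (s : ℝ), ContinuousOn (fun p : Plane × ℝ × ℝ => s *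
      (dirDeriv K (e i) (dirDeriv K (e i) g) p
        - p.2.2 * (inwardSign z₀ i * dirDeriv K (e i) g p))) K := fun i s =>
    (((contDiffOn_dirDeriv hKu (contDiffOn_dirDeriv hKu hg _) _).continuousOn).sub
      ((by fun_prop : Continuous fun p : Plane × ℝ × ℝ => p.2.2).continuousOn.mul
      ((contDiffOn_dirDeriv hKu hg _).continuousOn.const_mul _))).const_mul s
  obtain ⟨δ₀, hδ₀, hs₀⟩ := exists_pos_forall_lt_zero (hcontF 0 σ) hp (by
    simp only [hσ0]; linarith)
  obtain ⟨δ₁, hδ₁, hs₁⟩ := exists_pos_forall_lt_zero (hcontF 1 (-σ)) hp (by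
    simp only [← hσ]; linarith)
  -- The bound `r < 1` keeps the disc away from the two opposite sides.
  obtain ⟨r, hr, hrlt⟩ := exists_between (lt_min (lt_min hδ₀ hδ₁) (lt_min hε one_pos))
  simp only [lt_min_iff] at hrlt
  obtain ⟨⟨hrδ₀, hrδ₁⟩, hrε, hr1⟩ := hrlt
  have mono₀ : ∀ θ h, (θ, h) ∈ Ioo (θ₀ - η) (θ₀ + η) ×ˢ Ico 0 h₀ → |θ - θ₀| < δ₀ → |h| < δ₀ →
      ∀ x : Fin 2 → ℝ, (∀ j, 0 < x j) → x 0 ^ 2 + x 1 ^ 2 < r ^ 2 →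
      StrictAntiOn (fun t => Real.exp (-h * t) * (σ * g (inward z₀ (Function.update x 0 t), θ, h)))
        (Icc 0 (x 0)) := fun θ h hτ hθ hh x hx hxr =>
    strictAntiOn_exp_mul_inward hz₀ hg hτ (heigen θ hτ.1 h hτ.2) hr hr1.le hrε.le 0
      (fun z hz => hs₀ z θ h (hz.2.trans hrδ₀) hθ hh
        ⟨⟨hz.1, Metric.ball_subset_ball hrε.le hz.2⟩, hτ⟩) hx hxr
  have mono₁ : ∀ θ h, (θ, h) ∈ Ioo (θ₀ - η) (θ₀ + η) ×ˢ Ico 0 h₀ → |θ - θ₀| < δ₁ → |h| < δ₁ →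
      ∀ x : Fin 2 → ℝ, (∀ j, 0 < x j) → x 0 ^ 2 + x 1 ^ 2 < r ^ 2 →
      StrictAntiOn (fun t => Real.exp (-h * t) * (-σ * g (inward z₀ (Function.update x 1 t), θ, h)))
        (Icc 0 (x 1)) := fun θ h hτ hθ hh x hx hxr =>
    strictAntiOn_exp_mul_inward hz₀ hg hτ (heigen θ hτ.1 h hτ.2) hr hr1.le hrε.le 1
      (fun z hz => hs₁ z θ h (hz.2.trans hrδ₁) hθ hh
        ⟨⟨hz.1, Metric.ball_subset_ball hrε.le hz.2⟩, hτ⟩) hx hxr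
  have hdiag' : g (inward z₀ ![r / 2, r / 2], θ₀, 0) = 0 := by
    -- Each coordinate of modulus `π/2` shrinks by `r/2`, a proportion `r/π`.
    have h1 : inward z₀ ![r / 2, r / 2] = (1 - r / Real.pi) • z₀ := by
      have := Real.pi_pos
      ext i
      change z₀ i + inwardSign z₀ i * ![r / 2, r / 2] i = (1 - r / Real.pi) * z₀ i
      have h2 : ![r / 2, r / 2] i = r / 2 := by fin_cases i <;> rfl
      rw [h2, inwardSign]
      field_simp
      ring
    rw [h1]
    have h3 : r / Real.pi ≤ 1 := (div_le_one Real.pi_pos).2 (by linarith [Real.pi_gt_three])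
    have h4 : 0 < r / Real.pi := div_pos hr Real.pi_pos
    exact hdiag 0 hτ₀.2 _ ⟨by linarith, by linarith⟩
  have hsample : ∀ x y : ℝ, 0 < x → 0 < y → x ≤ r / 2 → y ≤ r / 2 →
      inward z₀ ![x, y] ∈ Metric.ball z₀ r ∩ square := by
    intro x y hx hy hx' hy'
    refine ⟨(inward_mem_ball hz₀ hr).2 ?_, fun i => abs_inward_lt hz₀ ?_ ?_⟩
    · simp only [Matrix.cons_val_zero, Matrix.cons_val_one, Matrix.cons_val_fin_one]; nlinarith
    · fin_cases i <;> simpa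
    · fin_cases i
      · simp only [Fin.zero_eta, Matrix.cons_val_zero]; linarith
      · simp only [Fin.mk_one, Matrix.cons_val_one, Matrix.cons_val_fin_one]; linarith
  have hr2 : ∀ j, 0 < (![r / 2, r / 2] : Fin 2 → ℝ) j := fun j => by
    fin_cases j <;> simpa using half_pos hr
  have hr2' : (![r / 2, r / 2] : Fin 2 → ℝ) 0 ^ 2 + (![r / 2, r / 2] : Fin 2 → ℝ) 1 ^ 2 < r ^ 2 := by
    simp only [Matrix.cons_val_zero, Matrix.cons_val_one, Matrix.cons_val_fin_one]; nlinarith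
  have hup0 : ∀ t : ℝ, Function.update ![r / 2, r / 2] 0 t = ![t, r / 2] := fun t => by
    ext j; fin_cases j <;> simp
  have hup1 : ∀ t : ℝ, Function.update ![r / 2, r / 2] 1 t = ![r / 2, t] := fun t => by
    ext j; fin_cases j <;> simp
  -- Halving one coordinate of the diagonal zero `(r/2, r/2)` makes `σ Φ` positive at `(r/4, r/2)`
  -- and negative at `(r/2, r/4)`.
  have hm₀ := mono₀ θ₀ 0 hτ₀ (by simpa) (by simpa) _ hr2 hr2' (a := r / 4) (b := r / 2)
    ⟨by linarith, by simp only [Matrix.cons_val_zero]; linarith⟩ ⟨by linarith, le_rfl⟩ (by linarith)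
  have hm₁ := mono₁ θ₀ 0 hτ₀ (by simpa) (by simpa) _ hr2 hr2' (a := r / 4) (b := r / 2)
    ⟨by linarith, by simp only [Matrix.cons_val_one, Matrix.cons_val_fin_one]; linarith⟩
    ⟨by linarith, le_rfl⟩ (by linarith)
  simp only [hup0, hup1, hdiag', neg_zero, zero_mul, Real.exp_zero, one_mul, mul_zero] at hm₀ hm₁
  have hsub : ∀ z ∈ Metric.ball z₀ r ∩ square, ∀ τ ∈ Ioo (θ₀ - η) (θ₀ + η) ×ˢ Ico 0 h₀,
      (z, τ) ∈ K := fun z hz τ hτ =>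
    ⟨⟨square_subset_closedSquare hz.2, Metric.ball_subset_ball hrε.le hz.1⟩, hτ⟩
  have hA := hsample (r / 4) (r / 2) (by linarith) (by linarith) (by linarith) le_rfl
  have hB := hsample (r / 2) (r / 4) (by linarith) (by linarith) le_rfl (by linarith)
  obtain ⟨δ₂, hδ₂, hs₂⟩ := exists_pos_forall_lt_zero (hg.continuousOn.const_mul (-σ))
    (hsub _ hA _ hτ₀) (by linarith)
  obtain ⟨δ₃, hδ₃, hs₃⟩ := exists_pos_forall_lt_zero (hg.continuousOn.const_mul σ)
    (hsub _ hB _ hτ₀) (by linarith)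
  -- The parameter range is fixed after `r`, because the sample points, and hence `δ₂` and `δ₃`,
  -- depend on `r`.
  obtain ⟨η₀, hη₀, hlt⟩ := exists_between
    (lt_min (lt_min (lt_min hδ₀ hδ₁) (lt_min hδ₂ hδ₃)) (lt_min hη hh₀))
  simp only [lt_min_iff] at hlt
  obtain ⟨⟨⟨hη₀δ₀, hη₀δ₁⟩, hη₀δ₂, hη₀δ₃⟩, hη₀η, hη₀h₀⟩ := hlt
  refine ⟨r, η₀, hr, hrε, hη₀, hη₀η, hη₀h₀, fun θ h hh hle => ?_⟩
  have hθ : |θ - θ₀| ≤ η₀ := by linarith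
  have hh' : |h| ≤ η₀ := by rw [abs_of_nonneg hh]; linarith [abs_nonneg (θ - θ₀)]
  have hτ : (θ, h) ∈ Ioo (θ₀ - η) (θ₀ + η) ×ˢ Ico 0 h₀ := by
    have := abs_le.1 hθ
    have := abs_le.1 hh'
    exact ⟨⟨by linarith, by linarith⟩, hh, by linarith⟩
  rw [← nodalDomains_const_mul hσne]
  refine ncard_nodalDomains_corner (h := h) hz₀ hr hr1.le ?_
    (mono₀ θ h hτ (hθ.trans_lt hη₀δ₀) (hh'.trans_lt hη₀δ₀)) ?_ ⟨_, hA, ?_⟩ ⟨_, hB, ?_⟩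
  · exact (hg.continuousOn.const_mul σ).comp (by fun_prop) fun z hz => hsub z hz _ hτ
  · simpa only [neg_mul] using mono₁ θ h hτ (hθ.trans_lt hη₀δ₁) (hh'.trans_lt hη₀δ₁)
  · have := hs₂ _ θ h (by simpa) (hθ.trans_lt hη₀δ₂) (hh'.trans_lt hη₀δ₂) (hsub _ hA _ hτ)
    linarith
  · exact hs₃ _ θ h (by simpa) (hθ.trans_lt hη₀δ₃) (hh'.trans_lt hη₀δ₃) (hsub _ hB _ hτ)

end RobinSquare

theorem mainTheorem6
    (Φ : RobinSquare.Plane → ℝ → ℝ → ℝ) (lam : ℝ → ℝ)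
    (z₀ : RobinSquare.Plane) (hz₀ : RobinSquare.IsCorner z₀)
    (θ₀ h₀ ε₁ η₁ : ℝ) (hh₀ : 0 < h₀) (hε₁ : 0 < ε₁) (hη₁ : 0 < η₁)
    -- a `C^∞` family, up to the boundary, near the corner
    (hsmooth : ContDiffOn ℝ ∞
      (fun p : RobinSquare.Plane × ℝ × ℝ => Φ p.1 p.2.1 p.2.2)
      ((RobinSquare.closedSquare ∩ Metric.ball z₀ ε₁) ×ˢ
        (Set.Ioo (θ₀ - η₁) (θ₀ + η₁) ×ˢ Set.Ico 0 h₀)))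
    -- of Robin eigenfunctions, the eigenvalue depending on `h` only
    (heigen : ∀ θ ∈ Set.Ioo (θ₀ - η₁) (θ₀ + η₁), ∀ h ∈ Set.Ico 0 h₀,
      RobinSquare.IsRobinEigenfunction h (lam h) (fun z => Φ z θ h))
    -- at `θ₀` it vanishes on the diagonal of the square through `z₀`
    (hdiag : ∀ h ∈ Set.Ico 0 h₀, ∀ t ∈ Set.Icc (-1 : ℝ) 1, Φ (t • z₀) θ₀ h = 0)
    -- `∇Φ(z₀, θ₀, h) = 0`
    (hcrit : ∀ h ∈ Set.Ico 0 h₀,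
      fderivWithin ℝ (fun z => Φ z θ₀ h) RobinSquare.closedSquare z₀ = 0)
    -- `∂²Φ/∂y² (z₀, θ₀, 0) ≠ 0`
    (hyy : iteratedFDerivWithin ℝ 2 (fun z => Φ z θ₀ 0) RobinSquare.closedSquare z₀
      ![EuclideanSpace.single 1 1, EuclideanSpace.single 1 1] ≠ 0)
    -- `∂Φ/∂θ (z₀, θ₀, 0) ≠ 0`
    (hθ : deriv (fun θ => Φ z₀ θ 0) θ₀ ≠ 0) :
    ∃ ε₀ η₀ : ℝ, 0 < ε₀ ∧ ε₀ < ε₁ ∧ 0 < η₀ ∧ η₀ < η₁ ∧ η₀ < h₀ ∧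
      ∀ θ h : ℝ, 0 ≤ h → |θ - θ₀| + h ≤ η₀ →
        (RobinSquare.nodalDomains (fun z => Φ z θ h)
          (Metric.ball z₀ ε₀ ∩ RobinSquare.square)).ncard = 2 := by
  set g : RobinSquare.Plane × ℝ × ℝ → ℝ := fun p => Φ p.1 p.2.1 p.2.2 with hg_def
  have hg : ContDiffOn ℝ ∞ g (RobinSquare.cornerDomain z₀ θ₀ h₀ ε₁ η₁) := hsmooth
  exact RobinSquare.exists_ncard_nodalDomains_eq_two (g := g) hz₀ hh₀ hε₁ hη₁ hg heigen hdiag hyy
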